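/- **Approximate additivity tester.** A function $h:\mathbb{R}^n\to\mathbb{R}$ is *additive* if $h(\boldsymbol p+\boldsymbol q)=h(\boldsymbol p)+h(\boldsymbol q)$ for all $\boldsymbol p,\boldsymbol q\in\mathbb{R}^n$ (no regularity is assumed). A probability distribution $\mathcal D$ on $\mathbb{R}^n$ is *$(\varepsilon/4,R)$-concentrated* if $\Pr_{\boldsymbol p\sim\mathcal D}[\|\boldsymbol p\|_2\le R]\ge 1-\varepsilon/4$. For $\boldsymbol p\in\mathbb{R}^n$ let $\kappa_{\boldsymbol p}=1$ if $\|\boldsymbol p\|_2\le 1/50$ and $\kappa_{\boldsymbol p}=\lceil 50\|\boldsymbol p\|_2\rceil$ otherwise. A *tester* is an adaptive randomized algorithm (a measurable decision procedure) that has query access to a function $f:\mathbb{R}^n\to\mathbb{R}$, sampling access to a distribution $\mathcal D$ on $\mathbb{R}^n$, and sampling access to the standard Gaussian $\mathcal N(\boldsymbol 0,I)$ as its internal randomness; it has no other information about $f$ and $\mathcal D$, and it finally accepts or rejects. There are absolute constants $K,C$ such that the following holds for all integers $n\ge 1$ and all reals $\alpha,\varepsilon>0$. Let $q=K\bigl(1+\tfrac1\varepsilon\log\tfrac1\varepsilon\bigr)$,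 so that $q=O(\tfrac1\varepsilon\log\tfrac1\varepsilon)$ for $\varepsilon\le 1/2$. 1. For every $R\ge 1/50$ there is a tester, depending only on $n,\alpha,\varepsilon,R$, that always makes at most $q$ queries to $f$ and draws at most $q$ samples from $\mathcal D$, such that for every $(\varepsilon/4,R)$-concentrated distribution $\mathcal D$: * (one-sided error) for every $f:\mathbb{R}^n\to\mathbb{R}$ for which some additive $h$ satisfies $|f(\boldsymbol p)-h(\boldsymbol p)|\le\alpha$ for all $\boldsymbol p\in\mathbb{R}^n$, it accepts with probability $1$; * for every Borel measurable $f:\mathbb{R}^n\to\mathbb{R}$ such that $\Pr_{\boldsymbol p\sim\mathcal D}\bigl[|f(\boldsymbol p)-h(\boldsymbol p)|>C R\,n^{1.5}\alpha\bigr]>\varepsilon$ for every additive $h$, it rejects with probability at least $2/3$. 2. (Fully distribution-free variant) There is a tester, depending only on $n,\alpha,\varepsilon$, with the same bounds on queries and samples, such that for every probability distribution $\mathcal D$ on $\mathbb{R}^n$: * for every $f:\mathbb{R}^n\to\mathbb{R}$ for which some additive $h$ satisfies $|f(\boldsymbol p)-h(\boldsymbol p)|\le\alpha$ for all $\boldsymbol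 p\in\mathbb{R}^n$, it accepts with probability $1$; * for every Borel measurable $f:\mathbb{R}^n\to\mathbb{R}$ such that $\Pr_{\boldsymbol p\sim\mathcal D}\bigl[|f(\boldsymbol p)-h(\boldsymbol p)|>C\,n^{1.5}\alpha\,\kappa_{\boldsymbol p}\bigr]>\varepsilon$ for every additive $h$, it rejects with probability at least $2/3$. (For additive $h$ for which the event is not measurable, $\Pr$ denotes outer probability.) -/

import Mathlib

open MeasureTheory ProbabilityTheory

noncomputable section

/-- `ℝⁿ` with the Euclidean norm. -/
abbrev RVec (n : ℕ) : Type := EuclideanSpace ℝ (Fin n)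

/-- Additive functions `ℝⁿ → ℝ` (Cauchy's functional equation; no regularity is required). -/
def IsAdditiveFun {n : ℕ} (h : RVec n → ℝ) : Prop :=
  ∀ x y : RVec n, h (x + y) = h x + h y

/-- `D` is `(ζ, R)`-concentrated: the ball of radius `R` around `0` has mass at least `1 - ζ`. -/
def IsConcentrated {n : ℕ} (D : Measure (RVec n)) (ζ R : ℝ) : Prop :=
  1 - ζ ≤ D.real (Metric.closedBall (0 : RVec n) R)

/-- `f` is pointwise `α`-close to some additive function. -/
def IsCloseToAdditive {n : ℕ} (f : RVec n → ℝ) (α : ℝ) : Prop :=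
  ∃ h : RVec n → ℝ, IsAdditiveFun h ∧ ∀ p, |f p - h p| ≤ α

/-- For every additive `h`, `Pr_{p ∼ D} [|f p - h p| > β p] > ε`; the error threshold `β` may
depend on the point. -/
def IsFarFromAdditive {n : ℕ} (D : Measure (RVec n)) (f : RVec n → ℝ) (β : RVec n → ℝ)
    (ε : ℝ) : Prop :=
  ∀ h : RVec n → ℝ, IsAdditiveFun h → ENNReal.ofReal ε < D {p | β p < |f p - h p|}

/-- The contraction factor `κ_p`, for the small radius `1 / 50`. -/
def kappa {n : ℕ} (p : RVec n) : ℝ :=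
  if ‖p‖ ≤ 1 / 50 then 1 else (⌈‖p‖ / (1 / 50)⌉₊ : ℝ)

/-- Adaptive randomized algorithms with query access to a function `f : ℝⁿ → ℝ`, sampling access
to a distribution `D` on `ℝⁿ`, and sampling access to the standard Gaussian `N(0, I)` as their
own source of randomness. Every continuation depends only on the value just received (and on
the values received before), so that the algorithm knows `f` and `D` through its accesses
only. -/
inductive Tester (n : ℕ) : Type where
  /-- Stop: accept (`true`) or reject (`false`). -/
  | answer (b : Bool) : Tester n
  /-- Query `f` at `x` and continue with the value `f x`. -/
  | query (x : RVec n) (next : ℝ → Tester n) : Tester n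
  /-- Draw a fresh sample from `D` and continue with it. -/
  | sample (next : RVec n → Tester n) : Tester n
  /-- Draw a fresh sample from `N(0, I)` and continue with it. -/
  | gaussian (next : RVec n → Tester n) : Tester n

namespace Tester

/-- The probability that the tester outputs `b`, when it runs on the function `f` and the
distribution `D`. -/
def outputProb {n : ℕ} (f : RVec n → ℝ) (D : Measure (RVec n)) (b : Bool) :
    Tester n → ENNReal
  | answer c => if c = b then 1 else 0
  | query x next => outputProb f D b (next (f x))
  | sample next => ∫⁻ p, outputProb f D b (next p) ∂D
  | gaussian next => ∫⁻ x, outputProb f D b (next x) ∂(stdGaussian (RVec n))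

/-- The tester is measurable: on Borel functions `f`, the conditional probability of each output
given the outcome of a random draw is a measurable function of that outcome. -/
def IsMeasurable {n : ℕ} : Tester n → Prop
  | answer _ => True
  | query _ next => ∀ y, IsMeasurable (next y)
  | sample next => (∀ p, IsMeasurable (next p)) ∧
      ∀ f : RVec n → ℝ, Measurable f → ∀ D : Measure (RVec n), IsProbabilityMeasure D →
        ∀ b : Bool, Measurable fun p => outputProb f D b (next p)
  | gaussian next => (∀ x, IsMeasurable (next x)) ∧
      ∀ f : RVec n → ℝ, Measurable f → ∀ D : Measure (RVec n), IsProbabilityMeasure D →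
        ∀ b : Bool, Measurable fun x => outputProb f D b (next x)

/-- The number of queries to `f`, in the worst case over all query answers and samples. -/
def queryCount {n : ℕ} : Tester n → ℕ∞
  | answer _ => 0
  | query _ next => 1 + ⨆ y, queryCount (next y)
  | sample next => ⨆ p, queryCount (next p)
  | gaussian next => ⨆ x, queryCount (next x)

/-- The number of samples from `D`, in the worst case over all query answers and samples. -/
def sampleCount {n : ℕ} : Tester n → ℕ∞
  | answer _ => 0
  | query _ next => ⨆ y, sampleCount (next y)
  | sample next => 1 + ⨆ p, sampleCount (next p)
  | gaussian next => ⨆ x, sampleCount (next x)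

/-- The tester uses at most `q` queries to `f` and at most `q` samples from `D`. -/
def CostAtMost {n : ℕ} (T : Tester n) (q : ℝ) : Prop :=
  ∃ m : ℕ, (m : ℝ) ≤ q ∧ T.queryCount ≤ m ∧ T.sampleCount ≤ m

/-- Over the distribution `D`, the tester distinguishes, with one-sided error, the functions that
are pointwise `α`-close to an additive function from those that are `ε`-far from every
additive function, with error threshold `β`. -/
def DistinguishesOver {n : ℕ} (T : Tester n) (D : Measure (RVec n)) (α : ℝ)
    (β : RVec n → ℝ) (ε : ℝ) : Prop :=
  (∀ f : RVec n → ℝ, IsCloseToAdditive f α → T.outputProb f D true = 1) ∧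
  (∀ f : RVec n → ℝ, Measurable f → IsFarFromAdditive D f β ε →
    2 / 3 ≤ T.outputProb f D false)

end Tester

end

noncomputable section

/-! The tester checks additivity of `f` at Gaussian pairs, then compares `f p`, for `p` drawn from
`D`, with its self-correction `κ (f (x + p/κ) - f x)` at a Gaussian `x`. If `f` is `α`-close to an
additive `h`, every check holds surely: an additivity check involves three errors, and a correction
check involves `1 + 2κ` of them, because `κ` is a natural number and so `κ h(p/κ) = h p`.

For soundness, suppose additivity fails by more than `3α` on at most a tenth of the Gaussian pairs;
otherwise twelve checks detect it. A translation by at most `1/50` changes Gaussian probabilities by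
at most `21/1000` (`stdGaussian_real_shift_le`). Hence, for short `p`, the increment `f (x + p) - f
x` is within `6α` of one value `g p` for most `x` (`exists_typical_increment`). Three such events
meet at a common `x`, which makes `g` additive up to `18α` on the ball of radius `1/50`.
Measurability of `f` makes `g` bounded there, so a Hyers-type argument on the ball puts `g` within
`O(nα)` of a linear map `h` (`exists_linear_near_of_almost_additive_on_ball`).

At a point where `f` is far from `h`, the correction check fails with probability at least `1/2`.
Such points have `D`-mass above `ε`, so `O(1/ε)` rounds suffice. -/

/-! ### Translates of the standard Gaussian. -/

theorem pi_withDensity_eq {ι : Type*} [Fintype ι] {X : ι → Type*} [∀ i, MeasurableSpace (X i)]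
    (μ : ∀ i, Measure (X i)) [∀ i, IsProbabilityMeasure (μ i)] (w : ∀ i, X i → ENNReal)
    (hw : ∀ i, Measurable (w i)) [∀ i, SigmaFinite ((μ i).withDensity (w i))] :
    Measure.pi (fun i => (μ i).withDensity (w i)) =
      (Measure.pi μ).withDensity (fun x => ∏ i, w i (x i)) := by
  refine Measure.pi_eq fun s hs => ?_
  have hf : ∀ i, Measurable ((s i).indicator (w i)) := fun i => (hw i).indicator (hs i)
  have hind : iIndepFun (fun i (x : ∀ i, X i) => (s i).indicator (w i) (x i)) (Measure.pi μ) :=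
    iIndepFun_pi fun i => (hf i).aemeasurable
  have h := lintegral_prod_eq_prod_lintegral_of_indepFun Finset.univ _ hind
    (fun i => (hf i).comp (measurable_pi_apply i))
  rw [withDensity_apply _ (MeasurableSet.univ_pi hs), ← lintegral_indicator (MeasurableSet.univ_pi hs)]
  have he : (Set.univ.pi s).indicator (fun x : ∀ i, X i => ∏ i, w i (x i)) =
      fun x => ∏ i, (s i).indicator (w i) (x i) := by
    funext x
    by_cases hx : x ∈ Set.univ.pi s
    · rw [Set.indicator_of_mem hx]
      exact Finset.prod_congr rfl fun i _ => (Set.indicator_of_mem (hx i (Set.mem_univ i)) _).symm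
    · rw [Set.indicator_of_notMem hx]
      simp only [Set.mem_pi, Set.mem_univ, true_implies, not_forall] at hx
      obtain ⟨i, hi⟩ := hx
      exact (Finset.prod_eq_zero (Finset.mem_univ i) (Set.indicator_of_notMem hi _)).symm
  rw [he, h]
  refine Finset.prod_congr rfl fun i _ => ?_
  rw [withDensity_apply _ (hs i), ← lintegral_indicator (hs i)]
  exact (measurePreserving_eval μ i).lintegral_comp (hf i)

theorem gaussianReal_map_add_eq_withDensity (a : ℝ) :
    (gaussianReal 0 1).map (fun x => x + a) =
      (gaussianReal 0 1).withDensity (fun x => ENNReal.ofReal (Real.exp (a * x - a ^ 2 / 2))) := by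
  rw [gaussianReal_map_add_const, gaussianReal_of_var_ne_zero _ one_ne_zero,
    gaussianReal_of_var_ne_zero _ one_ne_zero,
    ← withDensity_mul _ (measurable_gaussianPDF _ _) (by fun_prop)]
  congr 1
  funext x
  rw [Pi.mul_apply, gaussianPDF_def, gaussianPDF_def,
    ← ENNReal.ofReal_mul (gaussianPDFReal_nonneg _ _ _)]
  simp only [gaussianPDFReal_def, mul_assoc, ← Real.exp_add]
  congr 2
  simp only [NNReal.coe_one]
  ring_nf

/-- The density of the translate by `p` of the standard Gaussian. -/
def shiftDensity {n : ℕ} (p x : RVec n) : ℝ :=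
  Real.exp (∑ i, p i * x i - ‖p‖ ^ 2 / 2)

theorem shiftDensity_nonneg {n : ℕ} (p x : RVec n) : 0 ≤ shiftDensity p x :=
  (Real.exp_pos _).le

theorem measurable_shiftDensity {n : ℕ} (p : RVec n) : Measurable (shiftDensity p) := by
  unfold shiftDensity
  fun_prop

theorem stdGaussian_map_add_eq_withDensity {n : ℕ} (p : RVec n) :
    (stdGaussian (RVec n)).map (fun x => x + p) =
      (stdGaussian (RVec n)).withDensity (fun x => ENNReal.ofReal (shiftDensity p x)) := by
  have hshift : (Measure.pi fun _ : Fin n => gaussianReal 0 1).map (fun x i => x i + p i) =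
      (Measure.pi fun _ : Fin n => gaussianReal 0 1).withDensity
        (fun x => ∏ i, ENNReal.ofReal (Real.exp (p i * x i - p i ^ 2 / 2))) := by
    have : ∀ i, SigmaFinite ((gaussianReal 0 1).withDensity
        (fun x => ENNReal.ofReal (Real.exp (p i * x - p i ^ 2 / 2)))) := fun i => by
      rw [← gaussianReal_map_add_eq_withDensity, gaussianReal_map_add_const]
      infer_instance
    have hs : ∀ i, SigmaFinite ((gaussianReal 0 1).map (fun x => x + p i)) := fun i => by
      rw [gaussianReal_map_add_const]
      infer_instance
    rw [← pi_withDensity_eq (fun _ : Fin n => gaussianReal 0 1)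
      (fun i x => ENNReal.ofReal (Real.exp (p i * x - p i ^ 2 / 2))) (fun i => by fun_prop)]
    rw [Measure.pi_map_pi (f := fun i x => x + p i) (fun i => by fun_prop)]
    congr 1
    funext i
    exact gaussianReal_map_add_eq_withDensity (p i)
  have hL : Measurable (WithLp.toLp 2 : (Fin n → ℝ) → RVec n) := by fun_prop
  rw [← map_pi_eq_stdGaussian, Measure.map_map (by fun_prop) hL]
  have hc : (fun x : RVec n => x + p) ∘ (WithLp.toLp 2 : (Fin n → ℝ) → RVec n) =
      WithLp.toLp 2 ∘ (fun x i => x i + p i) := by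
    funext x
    ext i
    simp
  rw [hc, ← Measure.map_map hL (by fun_prop), hshift]
  ext A hA
  have hd := (measurable_shiftDensity p).ennreal_ofReal
  rw [Measure.map_apply hL hA, withDensity_apply _ (hL hA), withDensity_apply _ hA,
    setLIntegral_map hA hd hL]
  refine lintegral_congr fun x => ?_
  rw [← ENNReal.ofReal_prod_of_nonneg fun i _ => (Real.exp_pos _).le, ← Real.exp_sum,
    Finset.sum_sub_distrib, ← Finset.sum_div, shiftDensity, EuclideanSpace.real_norm_sq_eq]

theorem lintegral_shiftDensity {n : ℕ} (p : RVec n) :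
    ∫⁻ x, ENNReal.ofReal (shiftDensity p x) ∂(stdGaussian (RVec n)) = 1 := by
  have h := congrArg (fun μ => μ Set.univ) (stdGaussian_map_add_eq_withDensity p)
  simp only [withDensity_apply _ MeasurableSet.univ, Measure.restrict_univ] at h
  rw [← h, Measure.map_apply (by fun_prop) MeasurableSet.univ]
  simp

theorem integrable_shiftDensity {n : ℕ} (p : RVec n) :
    Integrable (shiftDensity p) (stdGaussian (RVec n)) := by
  refine ⟨(measurable_shiftDensity p).aestronglyMeasurable, ?_⟩
  rw [hasFiniteIntegral_iff_ofReal (ae_of_all _ (shiftDensity_nonneg p)),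
    lintegral_shiftDensity]
  exact ENNReal.one_lt_top

theorem integral_shiftDensity {n : ℕ} (p : RVec n) :
    ∫ x, shiftDensity p x ∂(stdGaussian (RVec n)) = 1 := by
  rw [integral_eq_lintegral_of_nonneg_ae (ae_of_all _ (shiftDensity_nonneg p))
    (measurable_shiftDensity p).aestronglyMeasurable, lintegral_shiftDensity, ENNReal.toReal_one]

/-- Since every shift density has mean `1`, this gives the second moment `exp (‖p‖ ^ 2)`, that is,
the chi-square distance of the translate. -/
theorem shiftDensity_sq {n : ℕ} (p x : RVec n) :
    shiftDensity p x ^ 2 = Real.exp (‖p‖ ^ 2) * shiftDensity ((2 : ℝ) • p) x := by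
  simp only [shiftDensity, ← Real.exp_nat_mul, ← Real.exp_add, norm_smul, PiLp.smul_apply,
    smul_eq_mul, mul_assoc, ← Finset.mul_sum]
  congr 1
  norm_num
  ring

/-- The excess of the translate on `A` is the integral of `W - 1` over `A`. Bounding `W - 1 ≤ 25 (W
- 1)² + 1/100` reduces it to the variance `exp (‖p‖ ^ 2) - 1` of the density. -/
theorem stdGaussian_real_shift_le {n : ℕ} {p : RVec n} (hp : ‖p‖ ≤ 1 / 50) {A : Set (RVec n)}
    (hA : MeasurableSet A) :
    (stdGaussian (RVec n)).real {x | x + p ∈ A} ≤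
      (stdGaussian (RVec n)).real A + 21 / 1000 := by
  set γ := stdGaussian (RVec n)
  set W := shiftDensity p
  have hW := integrable_shiftDensity p
  have hW2 : Integrable (fun x => W x ^ 2) γ := by
    simp only [W, shiftDensity_sq]
    exact (integrable_shiftDensity _).const_mul _
  have hI2 : ∫ x, W x ^ 2 ∂γ = Real.exp (‖p‖ ^ 2) := by
    simp only [W, shiftDensity_sq]
    rw [integral_const_mul, integral_shiftDensity, mul_one]
  have hexp : Real.exp (‖p‖ ^ 2) ≤ 1.00041 := by
    have h1 : ‖p‖ ^ 2 ≤ 1 / 2500 := by nlinarith [norm_nonneg p]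
    have h2 := Real.add_one_le_exp (-(1 / 2500 : ℝ))
    have h3 : Real.exp (‖p‖ ^ 2) ≤ Real.exp (1 / 2500) := Real.exp_le_exp.2 h1
    have h4 : Real.exp (1 / 2500) * Real.exp (-(1 / 2500)) = 1 := by
      rw [← Real.exp_add]; simp
    nlinarith [Real.exp_pos (1 / 2500 : ℝ)]
  have hreal : γ.real {x | x + p ∈ A} = ∫ x in A, W x ∂γ := by
    have h := congrArg (fun μ => μ A) (stdGaussian_map_add_eq_withDensity p)
    simp only [withDensity_apply _ hA] at h
    rw [Measure.map_apply (by fun_prop) hA] at h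
    rw [integral_eq_lintegral_of_nonneg_ae (ae_of_all _ (shiftDensity_nonneg p))
      (measurable_shiftDensity p).aestronglyMeasurable, ← h]
    rfl
  have h25 : Integrable (fun x => 25 * W x ^ 2) γ := hW2.const_mul 25
  have h50 : Integrable (fun x => 50 * W x) γ := hW.const_mul 50
  have hE0 : Integrable (fun x => 25 * W x ^ 2 - 50 * W x) γ := h25.sub h50
  -- The integrand is `25 (W - 1)² + 1/100`, with integral at most `25 · 0.00041 + 0.01 < 0.021`.
  have hE : Integrable (fun x => 25 * W x ^ 2 - 50 * W x + 25.01) γ :=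
    hE0.add (integrable_const _)
  have hEI : ∫ x, (25 * W x ^ 2 - 50 * W x + 25.01) ∂γ ≤ 21 / 1000 := by
    rw [integral_add hE0 (integrable_const _), integral_sub h25 h50, integral_const_mul,
      integral_const_mul, hI2, integral_shiftDensity]
    simp
    linarith
  have hle : ∫ x in A, W x ∂γ ≤
      ∫ x in A, (1 + (25 * W x ^ 2 - 50 * W x + 25.01)) ∂γ := by
    refine setIntegral_mono hW.integrableOn ((integrable_const 1).add hE).integrableOn fun x => ?_
    simp only
    nlinarith [sq_nonneg (W x - 1 - 1 / 50)]
  rw [integral_add (integrable_const _) hE.integrableOn] at hle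
  have hle2 : ∫ x in A, (25 * W x ^ 2 - 50 * W x + 25.01) ∂γ ≤
      ∫ x, (25 * W x ^ 2 - 50 * W x + 25.01) ∂γ :=
    setIntegral_le_integral hE (ae_of_all _ fun x => by
      simp only [Pi.zero_apply]
      nlinarith [sq_nonneg (W x - 1)])
  rw [setIntegral_const, smul_eq_mul, mul_one] at hle
  linarith

/-! ### Stability of the Cauchy equation on intervals and balls. -/

/-- After subtraction of the linear function that agrees with `φ` at `r`, doubling halves the bound
on `[0, r/2]`, and the reflection `t ↦ r - t` carries it to `[r/2, r]`. The bound `B` only starts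
the iteration and disappears in the limit. -/
theorem abs_sub_linear_le_of_almost_additive_on_Icc {φ : ℝ → ℝ} {r c B : ℝ} (hr : 0 < r)
    (hadd : ∀ s t, |s| ≤ r → |t| ≤ r → |s + t| ≤ r → |φ (s + t) - φ s - φ t| ≤ c)
    (hB : ∀ t, |t| ≤ r → |φ t| ≤ B) {t : ℝ} (ht : |t| ≤ r) :
    |φ t - t / r * φ r| ≤ 5 * c := by
  set ψ : ℝ → ℝ := fun t => φ t - t / r * φ r with hψ
  have hψr : ψ r = 0 := by simp [hψ, hr.ne']
  have hψadd : ∀ s t, |s| ≤ r → |t| ≤ r → |s + t| ≤ r → |ψ (s + t) - ψ s - ψ t| ≤ c := by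
    intro s t h1 h2 h3
    have h := hadd s t h1 h2 h3
    have : ψ (s + t) - ψ s - ψ t = φ (s + t) - φ s - φ t := by simp only [hψ]; ring
    rwa [this]
  have hc : 0 ≤ c := (abs_nonneg _).trans
    (hadd 0 0 (by simpa using hr.le) (by simpa using hr.le) (by simpa using hr.le))
  -- `3c` is the fixed point of `b ↦ (b + c)/2 + c`, where halving gives `(b + c)/2` and reflection
  -- adds `c`.
  have hstep : ∀ k : ℕ, ∀ t, 0 ≤ t → t ≤ r → |ψ t| ≤ 3 * c + 2 * B * (1 / 2) ^ k := by
    intro k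
    induction k with
    | zero =>
      intro t h0 h1
      have h2 := hB t (by rwa [abs_of_nonneg h0])
      have h3 := hB r (by rw [abs_of_pos hr])
      have h4 : |t / r * φ r| ≤ B := by
        rw [abs_mul, abs_of_nonneg (div_nonneg h0 hr.le)]
        have : t / r ≤ 1 := (div_le_one hr).2 h1
        nlinarith [abs_nonneg (φ r)]
      have h5 := abs_sub (φ t) (t / r * φ r)
      simp only [hψ, pow_zero]
      linarith
    | succ k ih =>
      have hhalf : ∀ t, 0 ≤ t → t ≤ r / 2 → |ψ t| ≤ 2 * c + 2 * B * (1 / 2) ^ (k + 1) := by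
        intro t h0 h1
        have h2 := hψadd t t (by rw [abs_of_nonneg h0]; linarith)
          (by rw [abs_of_nonneg h0]; linarith) (by rw [abs_of_nonneg (by linarith)]; linarith)
        have h3 := ih (t + t) (by linarith) (by linarith)
        rw [abs_le] at h2 h3 ⊢
        rw [pow_succ]
        constructor <;> linarith
      intro t h0 h1
      rcases le_total t (r / 2) with h | h
      · linarith [hhalf t h0 h]
      · have h2 := hψadd t (r - t) (by rwa [abs_of_nonneg h0])
          (by rw [abs_of_nonneg (by linarith)]; linarith)
          (by rw [add_sub_cancel, abs_of_pos hr])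
        have h3 := hhalf (r - t) (by linarith) (by linarith)
        rw [add_sub_cancel, hψr] at h2
        rw [abs_le] at h2 h3 ⊢
        constructor <;> linarith
  have hpos : ∀ t, 0 ≤ t → t ≤ r → |ψ t| ≤ 3 * c := by
    intro t h0 h1
    have hlim : Filter.Tendsto (fun k : ℕ => 3 * c + 2 * B * (1 / 2 : ℝ) ^ k) Filter.atTop
        (nhds (3 * c + 2 * B * 0)) :=
      ((tendsto_pow_atTop_nhds_zero_of_lt_one (by norm_num) (by norm_num)).const_mul _).const_add _
    simpa using ge_of_tendsto' hlim fun k => hstep k t h0 h1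
  change |ψ t| ≤ 5 * c
  rcases le_total 0 t with h | h
  · rw [abs_of_nonneg h] at ht
    linarith [hpos t h ht]
  -- Passing to `-t` costs `c` for additivity and `c` for `ψ 0`, hence `5c` in place of `3c`.
  · have h1 := hψadd t (-t) ht (by rwa [abs_neg]) (by simpa using hr.le)
    have h2 := hψadd 0 0 (by simpa using hr.le) (by simpa using hr.le) (by simpa using hr.le)
    rw [abs_of_nonpos h] at ht
    have h3 := hpos (-t) (by linarith) ht
    simp only [add_neg_cancel, add_zero] at h1 h2
    rw [abs_le] at h1 h2 h3 ⊢
    constructor <;> linarith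

/-- The vector `p` with the coordinates outside `s` replaced by `0`. -/
def coordRestrict {n : ℕ} (p : RVec n) (s : Finset (Fin n)) : RVec n :=
  WithLp.toLp 2 fun i => if i ∈ s then p i else 0

theorem norm_coordRestrict_le {n : ℕ} (p : RVec n) (s : Finset (Fin n)) :
    ‖coordRestrict p s‖ ≤ ‖p‖ := by
  rw [EuclideanSpace.norm_eq, EuclideanSpace.norm_eq]
  refine Real.sqrt_le_sqrt (Finset.sum_le_sum fun i _ => ?_)
  by_cases h : i ∈ s <;> simp [coordRestrict, h, sq_nonneg]

theorem coordRestrict_univ {n : ℕ} (p : RVec n) : coordRestrict p Finset.univ = p := by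
  ext i
  simp [coordRestrict]

theorem coordRestrict_empty {n : ℕ} (p : RVec n) : coordRestrict p ∅ = 0 := by
  ext i
  simp [coordRestrict]

theorem coordRestrict_insert {n : ℕ} (p : RVec n) {s : Finset (Fin n)} {j : Fin n} (hj : j ∉ s) :
    coordRestrict p (insert j s) = EuclideanSpace.single j (p j) + coordRestrict p s := by
  ext i
  by_cases h : i = j
  · subst h
    simp [coordRestrict, hj]
  · simp [coordRestrict, h]

/-- The one-variable bound costs `5c` on each axis. Splitting `p` into its coordinates costs `c` per
coordinate and `c` for `g 0`; all partial vectors stay in the ball because deleting coordinates does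
not increase the norm. -/
theorem exists_linear_near_of_almost_additive_on_ball {n : ℕ} {g : RVec n → ℝ} {r c B : ℝ}
    (hr : 0 < r)
    (hadd : ∀ p q, ‖p‖ ≤ r → ‖q‖ ≤ r → ‖p + q‖ ≤ r → |g (p + q) - g p - g q| ≤ c)
    (hB : ∀ p, ‖p‖ ≤ r → |g p| ≤ B) :
    ∃ h : RVec n →ₗ[ℝ] ℝ, ∀ p, ‖p‖ ≤ r → |g p - h p| ≤ (6 * n + 1) * c := by
  let h : RVec n →ₗ[ℝ] ℝ := ∑ i, (g (EuclideanSpace.single i r) / r) •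
    (EuclideanSpace.proj i : RVec n →L[ℝ] ℝ).toLinearMap
  have hh : ∀ p, h p = ∑ i, p i / r * g (EuclideanSpace.single i r) := by
    intro p
    simp only [h, LinearMap.sum_apply, LinearMap.smul_apply, smul_eq_mul]
    refine Finset.sum_congr rfl fun i _ => ?_
    change _ * p i = _
    ring
  refine ⟨h, fun p hp => ?_⟩
  have hcoord : ∀ i, |p i| ≤ r := fun i => (PiLp.norm_apply_le p i).trans hp
  have hone : ∀ i, |g (EuclideanSpace.single i (p i)) - p i / r * g (EuclideanSpace.single i r)|
      ≤ 5 * c := by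
    intro i
    refine abs_sub_linear_le_of_almost_additive_on_Icc
      (φ := fun t => g (EuclideanSpace.single i t)) (B := B) hr ?_ ?_ (hcoord i)
    · intro s t h1 h2 h3
      have he : (EuclideanSpace.single i (s + t) : RVec n) =
          EuclideanSpace.single i s + EuclideanSpace.single i t := by
        ext j
        by_cases hj : j = i <;> simp [hj]
      simp only [he]
      refine hadd _ _ (by simpa using h1) (by simpa using h2) ?_
      rw [← he]
      simpa using h3
    · intro t h1
      exact hB _ (by simpa using h1)
  have hsum : ∀ s : Finset (Fin n),
      |g (coordRestrict p s) - ∑ i ∈ s, g (EuclideanSpace.single i (p i))| ≤ (s.card + 1) * c := by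
    intro s
    induction s using Finset.induction_on with
    | empty =>
      have h0 := hadd 0 0 (by simpa using hr.le) (by simpa using hr.le) (by simpa using hr.le)
      simpa [coordRestrict_empty] using h0
    | insert j s hj ih =>
      have hn : ‖coordRestrict p (insert j s)‖ ≤ r := (norm_coordRestrict_le p _).trans hp
      rw [coordRestrict_insert p hj] at hn ⊢
      have h1 := hadd (EuclideanSpace.single j (p j)) (coordRestrict p s)
        (by simpa using hcoord j) ((norm_coordRestrict_le p _).trans hp) hn
      rw [Finset.sum_insert hj, Finset.card_insert_of_notMem hj]
      push_cast
      rw [abs_le] at h1 ih ⊢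
      constructor <;> linarith
  have h1 := hsum Finset.univ
  rw [coordRestrict_univ, Finset.card_univ, Fintype.card_fin] at h1
  have h2 : |∑ i, g (EuclideanSpace.single i (p i)) - h p| ≤ n * (5 * c) := by
    rw [hh, ← Finset.sum_sub_distrib]
    refine (Finset.abs_sum_le_sum_abs _ _).trans ((Finset.sum_le_sum fun i _ => hone i).trans ?_)
    simp
  have h3 := abs_sub_le (g p) (∑ i, g (EuclideanSpace.single i (p i))) (h p)
  linarith

/-! ### Typical increments and the linear approximation. -/

theorem exists_notMem_of_measureReal_add_lt_one {X : Type*} [MeasurableSpace X] {μ : Measure X}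
    [IsProbabilityMeasure μ] {A B C : Set X} (h : μ.real A + μ.real B + μ.real C < 1) :
    ∃ x, x ∉ A ∧ x ∉ B ∧ x ∉ C := by
  by_contra! hcon
  have hu : A ∪ B ∪ C = Set.univ := by
    ext x
    have := hcon x
    simp only [Set.mem_union, Set.mem_univ, iff_true]
    tauto
  have h1 := measureReal_union_le (μ := μ) (A ∪ B) C
  have h2 := measureReal_union_le (μ := μ) A B
  rw [hu, probReal_univ] at h1
  linarith

/-- This is where measurability of `f` yields boundedness of the increments, which excludes wild
additive functions. -/
theorem exists_measureReal_abs_gt_le {X : Type*} [MeasurableSpace X] (μ : Measure X)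
    [IsProbabilityMeasure μ] {f : X → ℝ} (hf : Measurable f) {δ : ℝ} (hδ : 0 < δ) :
    ∃ M : ℝ, μ.real {x | M < |f x|} ≤ δ := by
  have hlim := tendsto_measure_iInter_atTop (μ := μ) (s := fun k : ℕ => {x | (k : ℝ) < |f x|})
    (fun k => (measurableSet_lt measurable_const hf.abs).nullMeasurableSet)
    (fun a b hab x hx => by
      have hx' : (b : ℝ) < |f x| := hx
      exact lt_of_le_of_lt (Nat.cast_le.2 hab) hx') ⟨0, measure_ne_top _ _⟩
  have he : ⋂ k : ℕ, {x | (k : ℝ) < |f x|} = ∅ := by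
    ext x
    obtain ⟨k, hk⟩ := exists_nat_ge |f x|
    simp only [Set.mem_iInter, Set.mem_ofPred_eq, Set.mem_empty_iff_false, iff_false, not_forall,
      not_lt]
    exact ⟨k, hk⟩
  rw [he, measure_empty] at hlim
  obtain ⟨k, hk⟩ := (hlim.eventually (gt_mem_nhds (ENNReal.ofReal_pos.2 hδ))).exists
  exact ⟨k, ENNReal.toReal_le_of_le_ofReal hδ.le hk.le⟩

theorem stdGaussian_shift_le {n : ℕ} {p : RVec n} (hp : ‖p‖ ≤ 1 / 50) {A : Set (RVec n)}
    (hA : MeasurableSet A) :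
    stdGaussian (RVec n) {x | x + p ∈ A} ≤
      stdGaussian (RVec n) A + ENNReal.ofReal (21 / 1000) := by
  have h := stdGaussian_real_shift_le hp hA
  rw [← ENNReal.toReal_le_toReal (measure_ne_top _ _) (by finiteness),
    ENNReal.toReal_add (measure_ne_top _ _) (by finiteness), ENNReal.toReal_ofReal (by norm_num)]
  exact h

theorem stdGaussian_prod_shift_snd_le {n : ℕ} {p : RVec n} (hp : ‖p‖ ≤ 1 / 50)
    {A : Set (RVec n × RVec n)} (hA : MeasurableSet A) :
    ((stdGaussian (RVec n)).prod (stdGaussian (RVec n))) {z | (z.1, z.2 + p) ∈ A} ≤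
      ((stdGaussian (RVec n)).prod (stdGaussian (RVec n))) A + ENNReal.ofReal (21 / 1000) := by
  have hm : Measurable fun z : RVec n × RVec n => (z.1, z.2 + p) := by fun_prop
  change ((stdGaussian (RVec n)).prod (stdGaussian (RVec n))) ((fun z => (z.1, z.2 + p)) ⁻¹' A) ≤ _
  rw [Measure.prod_apply (hm hA), Measure.prod_apply hA]
  calc _ ≤ ∫⁻ x, (stdGaussian (RVec n) (Prod.mk x ⁻¹' A) + ENNReal.ofReal (21 / 1000))
        ∂(stdGaussian (RVec n)) :=
        lintegral_mono fun x => stdGaussian_shift_le hp (measurable_prodMk_left hA)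
    _ = _ := by rw [lintegral_add_right _ measurable_const, lintegral_const, measure_univ, mul_one]

theorem stdGaussian_prod_shift_fst_le {n : ℕ} {p : RVec n} (hp : ‖p‖ ≤ 1 / 50)
    {A : Set (RVec n × RVec n)} (hA : MeasurableSet A) :
    ((stdGaussian (RVec n)).prod (stdGaussian (RVec n))) {z | (z.1 + p, z.2) ∈ A} ≤
      ((stdGaussian (RVec n)).prod (stdGaussian (RVec n))) A + ENNReal.ofReal (21 / 1000) := by
  have hm : Measurable fun z : RVec n × RVec n => (z.1 + p, z.2) := by fun_prop
  change ((stdGaussian (RVec n)).prod (stdGaussian (RVec n))) ((fun z => (z.1 + p, z.2)) ⁻¹' A) ≤ _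
  rw [Measure.prod_apply_symm (hm hA), Measure.prod_apply_symm hA]
  calc _ ≤ ∫⁻ y, (stdGaussian (RVec n) ((fun x => (x, y)) ⁻¹' A) + ENNReal.ofReal (21 / 1000))
        ∂(stdGaussian (RVec n)) :=
        lintegral_mono fun x => stdGaussian_shift_le hp (measurable_prodMk_right hA)
    _ = _ := by rw [lintegral_add_right _ measurable_const, lintegral_const, measure_univ, mul_one]

/-- The pairs at which additivity of `f` fails by more than `3 α`. -/
def additivityDefectSet {n : ℕ} (f : RVec n → ℝ) (α : ℝ) : Set (RVec n × RVec n) :=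
  {z | 3 * α < |f z.1 + f z.2 - f (z.1 + z.2)|}

theorem measurableSet_additivityDefectSet {n : ℕ} {f : RVec n → ℝ} (hf : Measurable f) (α : ℝ) :
    MeasurableSet (additivityDefectSet f α) := by
  unfold additivityDefectSet
  exact measurableSet_lt measurable_const (by fun_prop)

/-- The increments by `p` at `x` and at `y` are compared through `f (x + y + p)`, split as `(x + p)
+ y` and as `x + (y + p)`. Both pairs are translated Gaussian pairs, so the increments disagree with
probability at most `2 (1/10 + 21/1000)`; averaging provides one good base point. -/
theorem exists_typical_increment {n : ℕ} {f : RVec n → ℝ} (hf : Measurable f) {α : ℝ}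
    (hdef : ((stdGaussian (RVec n)).prod (stdGaussian (RVec n))) (additivityDefectSet f α) ≤
      ENNReal.ofReal (1 / 10)) {p : RVec n} (hp : ‖p‖ ≤ 1 / 50) :
    ∃ g : ℝ, (stdGaussian (RVec n)).real {x | 6 * α < |f (x + p) - f x - g|} ≤ 242 / 1000 := by
  set γ := stdGaussian (RVec n)
  set A := additivityDefectSet f α
  have hA : MeasurableSet A := measurableSet_additivityDefectSet hf α
  set E : Set (RVec n × RVec n) :=
    {z | 6 * α < |f (z.2 + p) - f z.2 - (f (z.1 + p) - f z.1)|} with hE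
  have hEm : MeasurableSet E := measurableSet_lt measurable_const (by fun_prop)
  have hsub : E ⊆ {z | (z.1 + p, z.2) ∈ A} ∪ {z | (z.1, z.2 + p) ∈ A} := by
    intro z hz
    by_contra hcon
    simp only [Set.mem_union, Set.mem_ofPred_eq, not_or, A, additivityDefectSet, not_lt] at hcon
    obtain ⟨h1, h2⟩ := hcon
    have he : z.1 + p + z.2 = z.1 + (z.2 + p) := by abel
    rw [he] at h1
    have h3 : |f (z.2 + p) - f z.2 - (f (z.1 + p) - f z.1)| ≤ 6 * α := by
      rw [abs_le] at h1 h2 ⊢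
      constructor <;> linarith
    exact absurd hz (not_lt.2 h3)
  have hle : (γ.prod γ) E ≤ ENNReal.ofReal (242 / 1000) := by
    calc (γ.prod γ) E ≤ _ := measure_mono hsub
      _ ≤ _ := measure_union_le _ _
      _ ≤ ((γ.prod γ) A + ENNReal.ofReal (21 / 1000)) +
          ((γ.prod γ) A + ENNReal.ofReal (21 / 1000)) :=
        add_le_add (stdGaussian_prod_shift_fst_le hp hA) (stdGaussian_prod_shift_snd_le hp hA)
      _ ≤ (ENNReal.ofReal (1 / 10) + ENNReal.ofReal (21 / 1000)) +
          (ENNReal.ofReal (1 / 10) + ENNReal.ofReal (21 / 1000)) := by gcongr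
      _ = _ := by
        rw [← ENNReal.ofReal_add (by norm_num) (by norm_num),
          ← ENNReal.ofReal_add (by norm_num) (by norm_num)]
        norm_num
  rw [Measure.prod_apply hEm] at hle
  obtain ⟨y, hy⟩ := exists_le_lintegral (μ := γ) (f := fun x => γ (Prod.mk x ⁻¹' E))
    (measurable_measure_prodMk_left hEm).aemeasurable
  exact ⟨f (y + p) - f y, ENNReal.toReal_le_of_le_ofReal (by norm_num) (hy.trans hle)⟩

theorem exists_linear_of_additivityDefectSet_le {n : ℕ} (hn : 1 ≤ n) {f : RVec n → ℝ}
    (hf : Measurable f) {α : ℝ} (hα : 0 < α)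
    (hdef : ((stdGaussian (RVec n)).prod (stdGaussian (RVec n))) (additivityDefectSet f α) ≤
      ENNReal.ofReal (1 / 10)) :
    ∃ h : RVec n →ₗ[ℝ] ℝ, ∀ p, ‖p‖ ≤ 1 / 50 →
      1 / 2 ≤ (stdGaussian (RVec n)).real {x | |f (x + p) - f x - h p| ≤ 132 * n * α} := by
  set γ := stdGaussian (RVec n)
  -- The norm bound is placed inside the existential so that `choose` gives a total function,
  -- arbitrary off the ball.
  have hex : ∀ p : RVec n, ∃ g : ℝ, ‖p‖ ≤ 1 / 50 →
      γ.real {x | 6 * α < |f (x + p) - f x - g|} ≤ 242 / 1000 := by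
    intro p
    by_cases hp : ‖p‖ ≤ 1 / 50
    · obtain ⟨g, hg⟩ := exists_typical_increment hf hdef hp
      exact ⟨g, fun _ => hg⟩
    · exact ⟨0, fun h => absurd h hp⟩
  choose g hg using hex
  have hmeas : ∀ p, MeasurableSet {x | 6 * α < |f (x + p) - f x - g p|} := fun p =>
    measurableSet_lt measurable_const (by fun_prop)
  have hadd : ∀ p q : RVec n, ‖p‖ ≤ 1 / 50 → ‖q‖ ≤ 1 / 50 → ‖p + q‖ ≤ 1 / 50 →
      |g (p + q) - g p - g q| ≤ 18 * α := by
    intro p q hp hq hpq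
    have h1 := hg p hp
    have h2 := hg (p + q) hpq
    -- The increment by `q` is taken at the base point `x + p`; the three bad events have total mass
    -- at most `3 · 0.242 + 0.021 < 1`.
    have h3 := (stdGaussian_real_shift_le hp (hmeas q)).trans (add_le_add_left (hg q hq) _)
    obtain ⟨x, hx1, hx2, hx3⟩ := exists_notMem_of_measureReal_add_lt_one (μ := γ)
      (lt_of_le_of_lt (add_le_add (add_le_add h1 h2) h3) (by norm_num))
    simp only [Set.mem_ofPred_eq, not_lt, ← add_assoc] at hx1 hx2 hx3
    rw [abs_le] at hx1 hx2 hx3 ⊢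
    constructor <;> linarith
  obtain ⟨M, hM⟩ := exists_measureReal_abs_gt_le γ hf (δ := 1 / 10) (by norm_num)
  have hB : ∀ p : RVec n, ‖p‖ ≤ 1 / 50 → |g p| ≤ 2 * M + 6 * α := by
    intro p hp
    have h3 := (stdGaussian_real_shift_le hp (measurableSet_lt measurable_const hf.abs)).trans
      (add_le_add_left hM _)
    obtain ⟨x, hx1, hx2, hx3⟩ := exists_notMem_of_measureReal_add_lt_one (μ := γ)
      (lt_of_le_of_lt (add_le_add (add_le_add (hg p hp) hM) h3) (by norm_num))
    simp only [Set.mem_ofPred_eq, not_lt] at hx1 hx2 hx3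
    rw [abs_le] at hx1 hx2 hx3 ⊢
    constructor <;> linarith
  obtain ⟨h, hh⟩ := exists_linear_near_of_almost_additive_on_ball (by norm_num) hadd hB
  refine ⟨h, fun p hp => ?_⟩
  have hn' : (1 : ℝ) ≤ n := by exact_mod_cast hn
  have hcompl := probReal_compl_eq_one_sub (μ := γ) (hmeas p)
  have hsub : {x | 6 * α < |f (x + p) - f x - g p|}ᶜ ⊆
      {x | |f (x + p) - f x - h p| ≤ 132 * n * α} := by
    intro x hx
    simp only [Set.mem_compl_iff, Set.mem_ofPred_eq, not_lt] at hx ⊢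
    have h1 := hh p hp
    have h2 := abs_sub_le (f (x + p) - f x) (g p) (h p)
    -- `6α + 18(6n + 1)α = (24 + 108n)α ≤ 132nα`, as `n ≥ 1`.
    nlinarith
  have hmono := measureReal_mono (μ := γ) hsub
  have := hg p hp
  linarith

/-! ### The contraction factor and the two checks. -/

theorem one_le_kappa {n : ℕ} (p : RVec n) : 1 ≤ kappa p := by
  unfold kappa
  split_ifs with h
  · exact le_rfl
  · push Not at h
    have : (0 : ℝ) < ‖p‖ / (1 / 50) := by positivity
    exact_mod_cast Nat.ceil_pos.2 this

theorem norm_inv_kappa_smul_le {n : ℕ} (p : RVec n) : ‖(kappa p)⁻¹ • p‖ ≤ 1 / 50 := by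
  have hk := one_le_kappa p
  rw [norm_smul, norm_inv, Real.norm_of_nonneg (by linarith), inv_mul_le_iff₀ (by linarith)]
  unfold kappa
  split_ifs with h
  · linarith
  · have := Nat.le_ceil (‖p‖ / (1 / 50))
    linarith

theorem kappa_le {n : ℕ} {p : RVec n} {R : ℝ} (hR : 1 / 50 ≤ R) (hp : ‖p‖ ≤ R) :
    kappa p ≤ 100 * R := by
  unfold kappa
  split_ifs with h
  · linarith
  · have := Nat.ceil_lt_add_one (a := ‖p‖ / (1 / 50)) (by positivity)
    linarith

theorem measurable_kappa {n : ℕ} : Measurable (kappa (n := n)) := by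
  unfold kappa
  refine Measurable.ite (measurableSet_le measurable_norm measurable_const) measurable_const ?_
  exact (measurable_from_nat (f := fun k : ℕ => (k : ℝ))).comp
    (Nat.measurable_ceil.comp (measurable_norm.div_const _))

theorem IsAdditiveFun.map_nsmul {n : ℕ} {h : RVec n → ℝ} (hh : IsAdditiveFun h) (k : ℕ)
    (x : RVec n) : h ((k : ℝ) • x) = k * h x := by
  have := (AddMonoidHom.mk' h hh).map_nsmul k x
  rw [Nat.cast_smul_eq_nsmul, ← nsmul_eq_mul]
  exact this

/-- Integrality of `kappa p` is essential: an additive function need not be homogeneous over the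
reals. -/
theorem IsAdditiveFun.map_inv_kappa_smul {n : ℕ} {h : RVec n → ℝ} (hh : IsAdditiveFun h)
    (p : RVec n) : kappa p * h ((kappa p)⁻¹ • p) = h p := by
  obtain ⟨k, hk⟩ : ∃ k : ℕ, kappa p = k := by
    unfold kappa
    split_ifs
    · exact ⟨1, by simp⟩
    · exact ⟨_, rfl⟩
  have h0 : kappa p ≠ 0 := (zero_lt_one.trans_le (one_le_kappa p)).ne'
  conv_lhs => rw [hk]
  rw [← hh.map_nsmul, ← hk, smul_smul, mul_inv_cancel₀ h0, one_smul]

/-- The pairs at which the additivity check succeeds. -/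
def additivityPassSet {n : ℕ} (f : RVec n → ℝ) (α : ℝ) : Set (RVec n × RVec n) :=
  {z | |f z.1 + f z.2 - f (z.1 + z.2)| ≤ 3 * α}

/-- The pairs at which the comparison of `f` with its self-correction succeeds. -/
def correctionPassSet {n : ℕ} (f : RVec n → ℝ) (α : ℝ) : Set (RVec n × RVec n) :=
  {z | |f z.1 - kappa z.1 * (f (z.2 + (kappa z.1)⁻¹ • z.1) - f z.2)| ≤ (1 + 2 * kappa z.1) * α}

theorem measurableSet_additivityPassSet {n : ℕ} {f : RVec n → ℝ} (hf : Measurable f) (α : ℝ) :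
    MeasurableSet (additivityPassSet f α) := by
  unfold additivityPassSet
  exact measurableSet_le (by fun_prop) measurable_const

theorem measurableSet_correctionPassSet {n : ℕ} {f : RVec n → ℝ} (hf : Measurable f) (α : ℝ) :
    MeasurableSet (correctionPassSet f α) := by
  have := measurable_kappa (n := n)
  unfold correctionPassSet
  exact measurableSet_le (by fun_prop) (by fun_prop)

theorem additivityPassSet_eq_univ {n : ℕ} {f : RVec n → ℝ} {α : ℝ} (hf : IsCloseToAdditive f α) :
    additivityPassSet f α = Set.univ := by
  obtain ⟨h, hh, hc⟩ := hf
  refine Set.eq_univ_of_forall fun z => ?_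
  have h1 := hc z.1
  have h2 := hc z.2
  have h3 := hc (z.1 + z.2)
  rw [hh] at h3
  change |f z.1 + f z.2 - f (z.1 + z.2)| ≤ 3 * α
  rw [abs_le] at h1 h2 h3 ⊢
  constructor <;> linarith

theorem correctionPassSet_eq_univ {n : ℕ} {f : RVec n → ℝ} {α : ℝ} (hf : IsCloseToAdditive f α) :
    correctionPassSet f α = Set.univ := by
  obtain ⟨h, hh, hc⟩ := hf
  refine Set.eq_univ_of_forall fun z => ?_
  have h1 := hc z.1
  have h2 := hc z.2
  have h3 := hc (z.2 + (kappa z.1)⁻¹ • z.1)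
  rw [hh] at h3
  have h4 := hh.map_inv_kappa_smul z.1
  have hk := one_le_kappa z.1
  have h5 : |f (z.2 + (kappa z.1)⁻¹ • z.1) - f z.2 - h ((kappa z.1)⁻¹ • z.1)| ≤ 2 * α := by
    rw [abs_le] at h2 h3 ⊢
    constructor <;> linarith
  have h6 := mul_le_mul_of_nonneg_left h5 (zero_le_one.trans hk)
  rw [← abs_of_nonneg (zero_le_one.trans hk), ← abs_mul, abs_of_nonneg (zero_le_one.trans hk)] at h6
  change |f z.1 - kappa z.1 * (f (z.2 + (kappa z.1)⁻¹ • z.1) - f z.2)| ≤ (1 + 2 * kappa z.1) * α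
  rw [abs_le] at h1 h6 ⊢
  constructor <;> linarith

/-- If the check passed at a typical `x`, then `f p` would be within `(1 + 2κ)α + 132nκα ≤ 135nκα`
of `h p`. -/
theorem two_inv_le_measure_correctionPassSet_compl {n : ℕ} (hn : 1 ≤ n) {f : RVec n → ℝ} {α : ℝ}
    (hα : 0 < α) {h : RVec n →ₗ[ℝ] ℝ}
    (hh : ∀ p, ‖p‖ ≤ 1 / 50 →
      1 / 2 ≤ (stdGaussian (RVec n)).real {x | |f (x + p) - f x - h p| ≤ 132 * n * α})
    {p : RVec n} (hp : 135 * (n : ℝ) ^ (3 / 2 : ℝ) * α * kappa p < |f p - h p|) :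
    2⁻¹ ≤ stdGaussian (RVec n) (Prod.mk p ⁻¹' (correctionPassSet f α)ᶜ) := by
  have h1 := hh _ (norm_inv_kappa_smul_le p)
  have hsub : {x | |f (x + (kappa p)⁻¹ • p) - f x - h ((kappa p)⁻¹ • p)| ≤ 132 * n * α} ⊆
      Prod.mk p ⁻¹' (correctionPassSet f α)ᶜ := by
    intro x hx hpass
    change |f p - kappa p * (f (x + (kappa p)⁻¹ • p) - f x)| ≤ (1 + 2 * kappa p) * α at hpass
    have hk := one_le_kappa p
    have h4 : kappa p * h ((kappa p)⁻¹ • p) = h p := by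
      rw [map_smul, smul_eq_mul, mul_inv_cancel_left₀ (by linarith)]
    have hn1 : (1 : ℝ) ≤ n := by exact_mod_cast hn
    -- The exponent `3/2` enters only here; the argument itself loses a factor linear in `n`.
    have hn2 : (n : ℝ) ≤ (n : ℝ) ^ (3 / 2 : ℝ) := by
      simpa using Real.rpow_le_rpow_of_exponent_le hn1 (show (1 : ℝ) ≤ 3 / 2 by norm_num)
    have h5 : |kappa p * (f (x + (kappa p)⁻¹ • p) - f x) - h p| ≤ kappa p * (132 * n * α) := by
      rw [← h4, ← mul_sub, abs_mul, abs_of_pos (by linarith)]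
      exact mul_le_mul_of_nonneg_left hx (by linarith)
    have h6 := abs_sub_le (f p) (kappa p * (f (x + (kappa p)⁻¹ • p) - f x)) (h p)
    have h7 : kappa p * α ≤ (n : ℝ) ^ (3 / 2 : ℝ) * (kappa p * α) :=
      le_mul_of_one_le_left (by positivity) (hn1.trans hn2)
    have h8 : n * (kappa p * α) ≤ (n : ℝ) ^ (3 / 2 : ℝ) * (kappa p * α) :=
      mul_le_mul_of_nonneg_right hn2 (by positivity)
    have h9 : α ≤ kappa p * α := le_mul_of_one_le_left hα.le hk
    linarith
  have h2 : (2⁻¹ : ENNReal) = ENNReal.ofReal (1 / 2) := by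
    rw [one_div, ENNReal.ofReal_inv_of_pos two_pos, ENNReal.ofReal_ofNat]
  rw [h2]
  exact (ENNReal.ofReal_le_of_le_toReal h1).trans (measure_mono hsub)

theorem le_prod_correctionPassSet_compl {n : ℕ} (hn : 1 ≤ n) {f : RVec n → ℝ} (hf : Measurable f)
    {α ε : ℝ} (hα : 0 < α) {D : Measure (RVec n)} [IsProbabilityMeasure D]
    (hdef : ((stdGaussian (RVec n)).prod (stdGaussian (RVec n))) (additivityDefectSet f α) ≤
      ENNReal.ofReal (1 / 10))
    (hfar : IsFarFromAdditive D f (fun p => 135 * (n : ℝ) ^ (3 / 2 : ℝ) * α * kappa p) ε) :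
    2⁻¹ * ENNReal.ofReal ε ≤ (D.prod (stdGaussian (RVec n))) (correctionPassSet f α)ᶜ := by
  obtain ⟨h, hh⟩ := exists_linear_of_additivityDefectSet_le hn hf hα hdef
  have hm := (measurableSet_correctionPassSet hf α).compl
  rw [Measure.prod_apply hm]
  refine le_trans ?_ (mul_meas_ge_le_lintegral (measurable_measure_prodMk_left hm) 2⁻¹)
  gcongr
  exact (hfar h (fun x y => map_add h x y)).le.trans
    (measure_mono fun p hp => two_inv_le_measure_correctionPassSet_compl hn hα hh hp)

/-! ### Single rounds of the tester: probabilities, measurability, cost. -/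

theorem lintegral_lintegral_ite_mem {X Y : Type*} [MeasurableSpace X] [MeasurableSpace Y]
    (μ : Measure X) (ν : Measure Y) [SFinite ν] {S : Set (X × Y)} [DecidablePred (· ∈ S)]
    (hS : MeasurableSet S) (a b : ENNReal) :
    ∫⁻ x, ∫⁻ y, (if (x, y) ∈ S then a else b) ∂ν ∂μ = a * (μ.prod ν) S + b * (μ.prod ν) Sᶜ := by
  rw [← lintegral_prod (fun z => if z ∈ S then a else b)
    (Measurable.ite hS measurable_const measurable_const).aemeasurable,
    ← lintegral_add_compl _ hS]
  congr 1
  · rw [setLIntegral_congr_fun (g := fun _ => a) hS fun z hz => if_pos hz, setLIntegral_const]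
  · rw [setLIntegral_congr_fun (g := fun _ => b) hS.compl fun z hz => if_neg hz,
      setLIntegral_const]

theorem iterate_induction {X : Type*} {P : X → Prop} {F : X → X} (hF : ∀ x, P x → P (F x)) {x : X}
    (hx : P x) (k : ℕ) : P (F^[k] x) := by
  induction k with
  | zero => exact hx
  | succ k ih =>
    rw [Function.iterate_succ_apply']
    exact hF _ ih

namespace Tester

variable {n : ℕ}

open Classical in
/-- Check additivity of the tested function at two independent Gaussian points and continue with
`T` if the check succeeds. -/
def additivityRound (α : ℝ) (T : Tester n) : Tester n :=
  gaussian fun x => gaussian fun y => query x fun a => query y fun b => query (x + y) fun c =>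
    if |a + b - c| ≤ 3 * α then T else answer false

open Classical in
/-- Compare the tested function with its self-correction at a sample and continue with `T` if the
check succeeds. -/
def correctionRound (α : ℝ) (T : Tester n) : Tester n :=
  sample fun p => gaussian fun x => query p fun a => query x fun b =>
    query (x + (kappa p)⁻¹ • p) fun c =>
      if |a - kappa p * (c - b)| ≤ (1 + 2 * kappa p) * α then T else answer false

/-- `12` additivity checks followed by `m` comparisons of the function with its
self-correction. -/
def additivityTester (n : ℕ) (α : ℝ) (m : ℕ) : Tester n :=
  (additivityRound α)^[12] ((correctionRound α)^[m] (answer true))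

section Rounds

open Classical in
theorem outputProb_additivityRound (f : RVec n → ℝ) (D : Measure (RVec n)) (b : Bool) (α : ℝ)
    (T : Tester n) :
    outputProb f D b (additivityRound α T) =
      ∫⁻ x, ∫⁻ y, (if (x, y) ∈ additivityPassSet f α then outputProb f D b T
        else if false = b then 1 else 0) ∂(stdGaussian (RVec n)) ∂(stdGaussian (RVec n)) := by
  simp only [additivityRound, outputProb, apply_ite (outputProb f D b)]
  rfl

open Classical in
theorem outputProb_correctionRound (f : RVec n → ℝ) (D : Measure (RVec n)) (b : Bool) (α : ℝ)
    (T : Tester n) :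
    outputProb f D b (correctionRound α T) =
      ∫⁻ p, ∫⁻ x, (if (p, x) ∈ correctionPassSet f α then outputProb f D b T
        else if false = b then 1 else 0) ∂(stdGaussian (RVec n)) ∂D := by
  simp only [correctionRound, outputProb, apply_ite (outputProb f D b)]
  rfl

theorem outputProb_false_additivityRound {f : RVec n → ℝ} (hf : Measurable f)
    (D : Measure (RVec n)) (α : ℝ) (T : Tester n) :
    outputProb f D false (additivityRound α T) =
      outputProb f D false T *
        ((stdGaussian (RVec n)).prod (stdGaussian (RVec n))) (additivityPassSet f α) +
      ((stdGaussian (RVec n)).prod (stdGaussian (RVec n))) (additivityPassSet f α)ᶜ := by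
  classical
  rw [outputProb_additivityRound,
    lintegral_lintegral_ite_mem _ _ (measurableSet_additivityPassSet hf α), if_pos rfl, one_mul]

theorem outputProb_false_correctionRound {f : RVec n → ℝ} (hf : Measurable f)
    (D : Measure (RVec n)) (α : ℝ) (T : Tester n) :
    outputProb f D false (correctionRound α T) =
      outputProb f D false T * (D.prod (stdGaussian (RVec n))) (correctionPassSet f α) +
      (D.prod (stdGaussian (RVec n))) (correctionPassSet f α)ᶜ := by
  classical
  rw [outputProb_correctionRound,
    lintegral_lintegral_ite_mem _ _ (measurableSet_correctionPassSet hf α), if_pos rfl, one_mul]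

/-- The check holds at every pair, so the integrand is constant and `f` need not be measurable. -/
theorem outputProb_additivityRound_of_close {f : RVec n → ℝ} {α : ℝ} (hf : IsCloseToAdditive f α)
    (D : Measure (RVec n)) (b : Bool) (T : Tester n) :
    outputProb f D b (additivityRound α T) = outputProb f D b T := by
  rw [outputProb_additivityRound]
  simp [additivityPassSet_eq_univ hf]

theorem outputProb_correctionRound_of_close {f : RVec n → ℝ} {α : ℝ} (hf : IsCloseToAdditive f α)
    (D : Measure (RVec n)) [IsProbabilityMeasure D] (b : Bool) (T : Tester n) :
    outputProb f D b (correctionRound α T) = outputProb f D b T := by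
  rw [outputProb_correctionRound]
  simp [correctionPassSet_eq_univ hf]

theorem IsMeasurable.additivityRound {T : Tester n} (hT : T.IsMeasurable) (α : ℝ) :
    (additivityRound α T).IsMeasurable := by
  classical
  have hi : ∀ (c : Prop) [Decidable c], (if c then T else answer false).IsMeasurable := by
    intro c _
    split_ifs
    · exact hT
    · trivial
  refine ⟨fun x => ⟨fun y _ _ _ => hi _, fun f hf D _ b => ?_⟩, fun f hf D _ b => ?_⟩
  · simp only [outputProb, apply_ite (outputProb f D b)]
    exact Measurable.ite (measurableSet_le (by fun_prop) measurable_const) measurable_const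
      measurable_const
  · simp only [outputProb, apply_ite (outputProb f D b)]
    exact Measurable.lintegral_prod_right' (f := fun z : RVec n × RVec n =>
      if |f z.1 + f z.2 - f (z.1 + z.2)| ≤ 3 * α then outputProb f D b T
        else if false = b then 1 else 0)
      (Measurable.ite (measurableSet_additivityPassSet hf α) measurable_const measurable_const)

theorem IsMeasurable.correctionRound {T : Tester n} (hT : T.IsMeasurable) (α : ℝ) :
    (correctionRound α T).IsMeasurable := by
  classical
  have hi : ∀ (c : Prop) [Decidable c], (if c then T else answer false).IsMeasurable := by
    intro c _
    split_ifs
    · exact hT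
    · trivial
  refine ⟨fun p => ⟨fun x _ _ _ => hi _, fun f hf D _ b => ?_⟩, fun f hf D _ b => ?_⟩
  · simp only [outputProb, apply_ite (outputProb f D b)]
    exact Measurable.ite (measurableSet_le (by fun_prop) measurable_const) measurable_const
      measurable_const
  · simp only [outputProb, apply_ite (outputProb f D b)]
    exact Measurable.lintegral_prod_right' (f := fun z : RVec n × RVec n =>
      if |f z.1 - kappa z.1 * (f (z.2 + (kappa z.1)⁻¹ • z.1) - f z.2)| ≤ (1 + 2 * kappa z.1) * α
        then outputProb f D b T else if false = b then 1 else 0)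
      (Measurable.ite (measurableSet_correctionPassSet hf α) measurable_const measurable_const)

theorem queryCount_ite_le (T : Tester n) (c : Prop) [Decidable c] :
    (if c then T else answer false).queryCount ≤ T.queryCount := by
  split_ifs <;> simp [queryCount]

theorem sampleCount_ite_le (T : Tester n) (c : Prop) [Decidable c] :
    (if c then T else answer false).sampleCount ≤ T.sampleCount := by
  split_ifs <;> simp [sampleCount]

theorem queryCount_additivityRound_le (α : ℝ) (T : Tester n) :
    (additivityRound α T).queryCount ≤ 3 + T.queryCount := by
  have h3 : (3 : ℕ∞) + T.queryCount = 1 + (1 + (1 + T.queryCount)) := by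
    rw [← add_assoc, ← add_assoc]
    norm_num
  rw [h3]
  simp only [additivityRound, queryCount]
  exact iSup_le fun x => iSup_le fun y => add_le_add_right (iSup_le fun a =>
    add_le_add_right (iSup_le fun b => add_le_add_right (iSup_le fun c =>
      queryCount_ite_le T _) _) _) _

theorem queryCount_correctionRound_le (α : ℝ) (T : Tester n) :
    (correctionRound α T).queryCount ≤ 3 + T.queryCount := by
  have h3 : (3 : ℕ∞) + T.queryCount = 1 + (1 + (1 + T.queryCount)) := by
    rw [← add_assoc, ← add_assoc]
    norm_num
  rw [h3]
  simp only [correctionRound, queryCount]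
  exact iSup_le fun x => iSup_le fun y => add_le_add_right (iSup_le fun a =>
    add_le_add_right (iSup_le fun b => add_le_add_right (iSup_le fun c =>
      queryCount_ite_le T _) _) _) _

theorem sampleCount_additivityRound_le (α : ℝ) (T : Tester n) :
    (additivityRound α T).sampleCount ≤ T.sampleCount :=
  iSup_le fun _ => iSup_le fun _ => iSup_le fun _ => iSup_le fun _ => iSup_le fun _ =>
    sampleCount_ite_le T _

theorem sampleCount_correctionRound_le (α : ℝ) (T : Tester n) :
    (correctionRound α T).sampleCount ≤ 1 + T.sampleCount :=
  add_le_add_right (iSup_le fun _ => iSup_le fun _ => iSup_le fun _ => iSup_le fun _ =>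
    iSup_le fun _ => sampleCount_ite_le T _) _

end Rounds

/-! ### The whole tester: cost, completeness, soundness. -/

theorem isMeasurable_additivityTester (n : ℕ) (α : ℝ) (m : ℕ) :
    (additivityTester n α m).IsMeasurable := by
  have h : ((correctionRound α)^[m] (answer true : Tester n)).IsMeasurable :=
    iterate_induction (P := IsMeasurable) (fun _ h => h.correctionRound α)
      (show (answer true : Tester n).IsMeasurable from trivial) m
  exact iterate_induction (P := IsMeasurable) (fun _ h => h.additivityRound α) h 12

theorem queryCount_additivityTester_le (n : ℕ) (α : ℝ) (m : ℕ) :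
    (additivityTester n α m).queryCount ≤ (36 + 3 * m : ℕ) := by
  have h1 : ∀ k : ℕ, ((correctionRound α)^[k] (answer true : Tester n)).queryCount ≤
      (3 * k : ℕ) := by
    intro k
    induction k with
    | zero => simp [queryCount]
    | succ k ih =>
      rw [Function.iterate_succ_apply']
      refine (queryCount_correctionRound_le α _).trans ((add_le_add_right ih 3).trans ?_)
      norm_cast
      omega
  have h2 : ∀ k : ℕ, ((additivityRound α)^[k]
      ((correctionRound α)^[m] (answer true : Tester n))).queryCount ≤ (3 * k + 3 * m : ℕ) := by
    intro k
    induction k with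
    | zero => simpa using h1 m
    | succ k ih =>
      rw [Function.iterate_succ_apply']
      refine (queryCount_additivityRound_le α _).trans ((add_le_add_right ih 3).trans ?_)
      norm_cast
      omega
  exact h2 12

theorem sampleCount_additivityTester_le (n : ℕ) (α : ℝ) (m : ℕ) :
    (additivityTester n α m).sampleCount ≤ m := by
  have h1 : ∀ k : ℕ, ((correctionRound α)^[k] (answer true : Tester n)).sampleCount ≤ k := by
    intro k
    induction k with
    | zero => simp [sampleCount]
    | succ k ih =>
      rw [Function.iterate_succ_apply']
      refine (sampleCount_correctionRound_le α _).trans ((add_le_add_right ih 1).trans ?_)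
      norm_cast
      omega
  exact iterate_induction (P := fun T : Tester n => T.sampleCount ≤ m)
    (fun T h => (sampleCount_additivityRound_le α T).trans h) (h1 m) 12

theorem outputProb_additivityTester_of_close {f : RVec n → ℝ} {α : ℝ}
    (hf : IsCloseToAdditive f α) (D : Measure (RVec n)) [IsProbabilityMeasure D] (m : ℕ) :
    (additivityTester n α m).outputProb f D true = 1 := by
  have h : ((correctionRound α)^[m] (answer true : Tester n)).outputProb f D true = 1 :=
    iterate_induction (P := fun T => outputProb f D true T = 1)
      (fun T h => by rw [outputProb_correctionRound_of_close hf, h]) (by simp [outputProb]) m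
  exact iterate_induction (P := fun T => outputProb f D true T = 1)
    (fun T h => by rw [outputProb_additivityRound_of_close hf, h]) h 12

/-- If one round rejects with probability `1 - s` and continues otherwise, then `k` rounds reject
with probability at least `1 - s ^ k`. -/
theorem one_le_outputProb_iterate_add_pow {f : RVec n → ℝ} {D : Measure (RVec n)}
    {F : Tester n → Tester n} {s s' : ENNReal} (hs : s + s' = 1)
    (hF : ∀ T, outputProb f D false (F T) = outputProb f D false T * s + s') (T : Tester n)
    (k : ℕ) : 1 ≤ outputProb f D false (F^[k] T) + s ^ k := by
  induction k with
  | zero => simp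
  | succ k ih =>
    rw [Function.iterate_succ_apply', hF, pow_succ]
    calc (1 : ENNReal) = 1 * s + s' := by rw [one_mul, hs]
      _ ≤ (outputProb f D false (F^[k] T) + s ^ k) * s + s' := by gcongr
      _ = _ := by ring

theorem two_thirds_le_of_one_le_add {a b : ENNReal} (h : 1 ≤ a + b)
    (hb : b ≤ ENNReal.ofReal (1 / 3)) : 2 / 3 ≤ a := by
  have h1 : ENNReal.ofReal (1 / 3) = 1 / 3 := by
    rw [ENNReal.ofReal_div_of_pos (by norm_num)]
    simp
  rw [h1] at hb
  have h2 : (2 / 3 : ENNReal) + 1 / 3 = 1 := by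
    rw [← ENNReal.add_div]
    norm_num
    exact ENNReal.div_self (by norm_num) (by norm_num)
  refine ENNReal.le_of_add_le_add_right (a := 1 / 3) (by simp) ?_
  rw [h2]
  exact h.trans (add_le_add_right hb _)

theorem le_ofReal_one_sub {s s' : ENNReal} {c : ℝ} (hs : s + s' = 1) (hc : 0 ≤ c)
    (h : ENNReal.ofReal c ≤ s') : s ≤ ENNReal.ofReal (1 - c) := by
  rw [ENNReal.ofReal_sub _ hc, ENNReal.ofReal_one]
  refine ENNReal.le_sub_of_add_le_right ENNReal.ofReal_ne_top ?_
  rw [← hs]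
  gcongr

/-- Two cases, by the mass of the additivity defect: if it is large, the additivity rounds alone
reject often enough; if it is small, each correction round rejects with probability at least `ε/2`.
-/
theorem two_thirds_le_outputProb_additivityTester (hn : 1 ≤ n) {f : RVec n → ℝ}
    (hf : Measurable f) {α ε : ℝ} (hα : 0 < α) (hε : 0 < ε) (hε1 : ε ≤ 1)
    {D : Measure (RVec n)} [IsProbabilityMeasure D] {m : ℕ} (hm : 4 / ε ≤ m)
    (hfar : IsFarFromAdditive D f (fun p => 135 * (n : ℝ) ^ (3 / 2 : ℝ) * α * kappa p) ε) :
    2 / 3 ≤ (additivityTester n α m).outputProb f D false := by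
  set γ := stdGaussian (RVec n)
  have hs1 : (γ.prod γ) (additivityPassSet f α) + (γ.prod γ) (additivityPassSet f α)ᶜ = 1 :=
    prob_add_prob_compl (measurableSet_additivityPassSet hf α)
  have hs2 : (D.prod γ) (correctionPassSet f α) + (D.prod γ) (correctionPassSet f α)ᶜ = 1 :=
    prob_add_prob_compl (measurableSet_correctionPassSet hf α)
  have hcompl : (additivityPassSet f α)ᶜ = additivityDefectSet f α := by
    ext z
    exact not_le (a := |f z.1 + f z.2 - f (z.1 + z.2)|)
  have hF1 := outputProb_false_additivityRound hf D α
  have hF2 := outputProb_false_correctionRound hf D α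
  by_cases hdef : (γ.prod γ) (additivityDefectSet f α) ≤ ENNReal.ofReal (1 / 10)
  · have h1 : 2 / 3 ≤ ((correctionRound α)^[m] (answer true : Tester n)).outputProb f D false := by
      refine two_thirds_le_of_one_le_add (one_le_outputProb_iterate_add_pow hs2 hF2 _ m) ?_
      have h2 := le_prod_correctionPassSet_compl hn hf hα hdef hfar
      have h3 : (2⁻¹ : ENNReal) * ENNReal.ofReal ε = ENNReal.ofReal (ε / 2) := by
        rw [ENNReal.ofReal_div_of_pos two_pos, ENNReal.ofReal_ofNat, mul_comm, div_eq_mul_inv]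
      rw [h3] at h2
      have h4 := le_ofReal_one_sub hs2 (by positivity) h2
      refine (pow_le_pow_left' h4 m).trans ?_
      rw [← ENNReal.ofReal_pow (by linarith)]
      refine ENNReal.ofReal_le_ofReal ?_
      have h5 : 1 - ε / 2 ≤ Real.exp (-(ε / 2)) := by
        have := Real.add_one_le_exp (-(ε / 2))
        linarith
      have h6 : (4 : ℝ) ≤ m * ε := (div_le_iff₀ hε).1 hm
      -- The choice `m ≥ 4/ε` makes the exponent at most `-2`, and `exp 2 ≥ 3`.
      calc (1 - ε / 2) ^ m ≤ Real.exp (-(ε / 2)) ^ m := pow_le_pow_left₀ (by linarith) h5 m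
        _ = Real.exp (m * -(ε / 2)) := (Real.exp_nat_mul _ m).symm
        _ ≤ Real.exp (-2) := Real.exp_le_exp.2 (by linarith)
        _ ≤ 1 / 3 := by
          rw [Real.exp_neg, ← one_div]
          have := Real.add_one_le_exp (2 : ℝ)
          exact one_div_le_one_div_of_le (by norm_num) (by linarith)
    -- An additivity round in front either rejects or continues, so it preserves a rejection bound
    -- of `2/3`.
    refine iterate_induction (P := fun T => 2 / 3 ≤ outputProb f D false T)
      (fun T h => ?_) h1 12
    rw [hF1]
    have h23 : (2 / 3 : ENNReal) ≤ 1 := ENNReal.div_le_of_le_mul (by norm_num)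
    calc (2 / 3 : ENNReal) = 2 / 3 * ((γ.prod γ) (additivityPassSet f α)) +
          2 / 3 * (γ.prod γ) (additivityPassSet f α)ᶜ := by rw [← mul_add, hs1, mul_one]
      _ ≤ _ := add_le_add (mul_le_mul_left h _) (mul_le_of_le_one_left' h23)
  · refine two_thirds_le_of_one_le_add (one_le_outputProb_iterate_add_pow hs1 hF1 _ 12) ?_
    rw [← hcompl] at hdef
    refine (pow_le_pow_left' (le_ofReal_one_sub hs1 (by norm_num) (not_le.1 hdef).le) 12).trans ?_
    rw [← ENNReal.ofReal_pow (by norm_num)]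
    -- `(9/10) ^ 12 < 1/3`.
    exact ENNReal.ofReal_le_ofReal (by norm_num)

/-- With `x = 1/ε ≥ 1`, the cost is at most `39 + 24x ≤ 63x`, and `log x ≥ 1 - 1/x` gives `x ≤ 1 + x
log x`. -/
theorem costAtMost_additivityTester (n : ℕ) (α : ℝ) {ε : ℝ} (hε : 0 < ε) (hε1 : ε ≤ 1) :
    (additivityTester n α ⌈8 / ε⌉₊).CostAtMost (63 * (1 + 1 / ε * Real.log (1 / ε))) := by
  refine ⟨36 + 3 * ⌈8 / ε⌉₊, ?_, queryCount_additivityTester_le n α _,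
    (sampleCount_additivityTester_le n α _).trans (by norm_cast; omega)⟩
  have h1 := Nat.ceil_lt_add_one (a := 8 / ε) (by positivity)
  have h2 : 1 ≤ 1 / ε := (one_le_div hε).2 hε1
  have h3 := Real.one_sub_inv_le_log_of_pos (x := 1 / ε) (by positivity)
  have h4 := mul_le_mul_of_nonneg_left h3 (show 0 ≤ 1 / ε by positivity)
  rw [mul_sub, mul_inv_cancel₀ (by positivity)] at h4
  have h5 : 8 / ε = 8 * (1 / ε) := by ring
  push_cast
  linarith

end Tester

/-! ### From concentrated distributions to the distribution-free bound. -/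

theorem IsFarFromAdditive.lt_one {n : ℕ} {D : Measure (RVec n)} [IsProbabilityMeasure D]
    {f β : RVec n → ℝ} {ε : ℝ} (h : IsFarFromAdditive D f β ε) : ε < 1 := by
  have h1 := (h (fun _ => 0) (fun _ _ => by simp)).trans_le prob_le_one
  exact ENNReal.ofReal_lt_one.1 h1

/-- On the ball `kappa p ≤ 100 * R`, and its complement has mass at most `ε/4`, which leaves more
than `3ε/4` of bad points. Thus both variants can use the same tester. -/
theorem IsFarFromAdditive.of_isConcentrated {n : ℕ} {D : Measure (RVec n)}
    [IsProbabilityMeasure D] {f : RVec n → ℝ} {A R ε : ℝ} (hA : 0 ≤ A) (hε : 0 < ε)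
    (hR : 1 / 50 ≤ R) (hD : IsConcentrated D (ε / 4) R)
    (h : IsFarFromAdditive D f (fun _ => A * (100 * R)) ε) :
    IsFarFromAdditive D f (fun p => A * kappa p) (ε / 2) := by
  intro g hg
  have h1 := h g hg
  set B := Metric.closedBall (0 : RVec n) R
  have hB : D Bᶜ ≤ ENNReal.ofReal (ε / 4) := by
    refine ENNReal.le_ofReal_iff_toReal_le (measure_ne_top _ _) (by positivity) |>.2 ?_
    have h2 : D.real Bᶜ = 1 - D.real B :=
      probReal_compl_eq_one_sub Metric.isClosed_closedBall.measurableSet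
    have h3 : 1 - ε / 4 ≤ D.real B := hD
    change D.real Bᶜ ≤ _
    linarith
  have hsub : {p | A * (100 * R) < |f p - g p|} ⊆ {p | A * kappa p < |f p - g p|} ∪ Bᶜ := by
    intro p hp
    by_cases hpB : p ∈ B
    · refine Or.inl (lt_of_le_of_lt (mul_le_mul_of_nonneg_left (kappa_le hR ?_) hA) hp)
      simpa [B] using hpB
    · exact Or.inr hpB
  by_contra hcon
  have h4 := (measure_mono hsub).trans (measure_union_le (μ := D) _ _)
  have h5 := h4.trans (add_le_add (not_lt.1 hcon) hB)
  rw [← ENNReal.ofReal_add (by positivity) (by positivity)] at h5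
  exact absurd (h1.trans_le h5) (not_lt.2 (ENNReal.ofReal_le_ofReal (by linarith)))

end

theorem mainTheorem7 :
    ∃ K C : ℝ, ∀ (n : ℕ) (α ε : ℝ), 1 ≤ n → 0 < α → 0 < ε →
      (∀ R : ℝ, 1 / 50 ≤ R →
        ∃ T : Tester n, T.IsMeasurable ∧
          T.CostAtMost (K * (1 + 1 / ε * Real.log (1 / ε))) ∧
          ∀ D : MeasureTheory.Measure (RVec n), MeasureTheory.IsProbabilityMeasure D →
            IsConcentrated D (ε / 4) R →
            T.DistinguishesOver D α (fun _ => C * R * (n : ℝ) ^ (3 / 2 : ℝ) * α) ε) ∧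
      (∃ T : Tester n, T.IsMeasurable ∧
          T.CostAtMost (K * (1 + 1 / ε * Real.log (1 / ε))) ∧
          ∀ D : MeasureTheory.Measure (RVec n), MeasureTheory.IsProbabilityMeasure D →
            T.DistinguishesOver D α (fun p => C * (n : ℝ) ^ (3 / 2 : ℝ) * α * kappa p) ε) := by
  -- `13500 = 135 · 100`, where `100` comes from `kappa p ≤ 100 * R`; the distribution-free variant
  -- needs only `135`.
  refine ⟨63, 13500, fun n α ε hn hα hε => ?_⟩
  -- For `ε ≥ 1` no function is far, since the zero function is additive, so accepting at once is
  -- correct.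
  rcases le_or_gt 1 ε with hε1 | hε1
  · have hcost : (Tester.answer true : Tester n).CostAtMost
        (63 * (1 + 1 / ε * Real.log (1 / ε))) := by
      refine ⟨0, ?_, by simp [Tester.queryCount], by simp [Tester.sampleCount]⟩
      have h3 := Real.one_sub_inv_le_log_of_pos (x := 1 / ε) (by positivity)
      have h4 := mul_le_mul_of_nonneg_left h3 (show 0 ≤ 1 / ε by positivity)
      rw [mul_sub, mul_inv_cancel₀ (by positivity)] at h4
      have h5 : 0 < 1 / ε := by positivity
      push_cast
      linarith
    have hdist : ∀ D : Measure (RVec n), IsProbabilityMeasure D → ∀ β,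
        (Tester.answer true : Tester n).DistinguishesOver D α β ε := fun D _ β =>
      ⟨fun _ _ => by simp [Tester.outputProb], fun _ _ h => absurd h.lt_one (not_lt.2 hε1)⟩
    exact ⟨fun R _ => ⟨Tester.answer true, trivial, hcost, fun D hD _ => hdist D hD _⟩,
      ⟨Tester.answer true, trivial, hcost, fun D hD => hdist D hD _⟩⟩
  -- The round count is set for farness `ε/2`, which is what the concentrated case retains.
  · have hceil : 4 / (ε / 2) ≤ (⌈8 / ε⌉₊ : ℝ) := by
      have := Nat.le_ceil (8 / ε)
      have h : 4 / (ε / 2) = 8 / ε := by field_simp; norm_num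
      rwa [h]
    have hceil' : 4 / ε ≤ (⌈8 / ε⌉₊ : ℝ) :=
      (div_le_div_of_nonneg_left (by norm_num) (by positivity) (by linarith)).trans hceil
    refine ⟨fun R hR => ⟨Tester.additivityTester n α ⌈8 / ε⌉₊,
        Tester.isMeasurable_additivityTester n α _,
        Tester.costAtMost_additivityTester n α hε hε1.le, fun D hD hconc =>
        ⟨fun f hf => Tester.outputProb_additivityTester_of_close hf D _, fun f hf hfar => ?_⟩⟩,
      ⟨Tester.additivityTester n α ⌈8 / ε⌉₊,
        Tester.isMeasurable_additivityTester n α _,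
        Tester.costAtMost_additivityTester n α hε hε1.le, fun D hD =>
        ⟨fun f hf => Tester.outputProb_additivityTester_of_close hf D _, fun f hf hfar => ?_⟩⟩⟩
    · have he : (fun _ : RVec n => 13500 * R * (n : ℝ) ^ (3 / 2 : ℝ) * α) =
          fun _ => 135 * (n : ℝ) ^ (3 / 2 : ℝ) * α * (100 * R) := by
        funext _
        ring
      rw [he] at hfar
      exact Tester.two_thirds_le_outputProb_additivityTester hn hf hα (by positivity)
        (by linarith) hceil
        (IsFarFromAdditive.of_isConcentrated (by positivity) hε hR hconc hfar)
    · refine Tester.two_thirds_le_outputProb_additivityTester hn hf hα hε hε1.le hceil'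
        fun h hh => (hfar h hh).trans_le (measure_mono fun p hp => ?_)
      have hk := one_le_kappa p
      have hp' : 13500 * (n : ℝ) ^ (3 / 2 : ℝ) * α * kappa p < |f p - h p| := hp
      have hpos : 0 ≤ (n : ℝ) ^ (3 / 2 : ℝ) * α * kappa p := by positivity
      change 135 * (n : ℝ) ^ (3 / 2 : ℝ) * α * kappa p < |f p - h p|
      linarith
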